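/- **Theorem 5.1.** Let $F=GF(q)$ be a finite field of odd characteristic $p$ and let $n\ge 1$. Let $\psi(\alpha)=e^{(2\pi i/p)\,\mathrm{tr}(\alpha)}$ be the canonical additive character of $F$ ($\mathrm{tr}$ the trace to the prime field), $\chi$ the quadratic character of $F$, and $\delta=\chi(-1)$. Let $Sp(2n,q)$ be the group of matrices preserving the form $\varphi((x_1,y_1),(x_2,y_2))=x_1y_2^T-y_1x_2^T$ on row vectors, acting from the right on $V=F^{2n}$. *The Weil character.* On the $q^n$-dimensional space of functions $f:F^n\to\mathbb C$ let $(\rho(x,y)f)(t)=\psi(2xt^T-xy^T)f(t-y)$, so that $\rho(u)\rho(v)=\psi(\varphi(u,v))\rho(u+v)$ for $u,v\in V$. The Weil representation is the unique representation $W$ of $Sp(2n,q)$ on this space such that $W(g)^{-1}\rho(v)W(g)=\rho(vg)$ for all $g\in Sp(2n,q)$, $v\in V$, and such that each $W(g)$ (which preserves the spaces of even and of odd functions) has the same determinant on the even as on the odd functions. (The determinant condition is automatic except for $n=1$, $q=3$, where it selects one of three representations.) Let $\omega$ be the character of $W$. *The subgroup and its characters.* Let $B$ be the group of all $g_Q=\begin{bmatrix}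 I&0\\Q&I\end{bmatrix}$, $Q$ a symmetric $n\times n$ matrix over $F$, and $G=\langle -I\rangle\times B\le Sp(2n,q)$. For a symmetric matrix $S$ put $\lambda_S(g_Q)=\psi(\mathrm{Tr}(SQ))$ on $B$, and on $G$ put $\lambda_S^{\pm}(g_Q)=\psi(\mathrm{Tr}(SQ))$, $\lambda_S^{\pm}(-g_Q)=\pm\psi(\mathrm{Tr}(SQ))$. Let $\Delta(S)$ be $\chi$ of the product of the nonzero diagonal entries of a diagonal matrix $MSM^T$ with $M$ invertible (this does not depend on the choice of $M$). Then $$\omega|_G=\frac{1+\delta^n}{2}\lambda_0^{+}+\frac{1-\delta^n}{2}\lambda_0^{-}+\sum_{\substack{S=S^T,\ \mathrm{rank}\,S=1\\ \Delta(S)=\delta}}(\lambda_S^{+}+\lambda_S^{-}),$$ and in particular $$\omega|_B=\lambda_0+2\sum_{\substack{S=S^T,\ \mathrm{rank}\,S=1\\ \Delta(S)=\delta}}\lambda_S .$$ -/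

import Mathlib

namespace WeilSp
open Matrix

/-- The canonical additive character `ψ(α) = exp((2πi/p) tr(α))` of a finite field `F` of
characteristic `p`, `tr` being the trace from `F` to its prime field. -/
noncomputable def psi (F : Type*) [Field F] [Fintype F] : AddChar F ℂ :=
  letI : Algebra (ZMod (ringChar F)) F := ZMod.algebra F (ringChar F)
  haveI : NeZero (ringChar F) := ⟨CharP.ringChar_ne_zero_of_finite F⟩
  (ZMod.stdAddChar (N := ringChar F)).compAddMonoidHom
    (Algebra.trace (ZMod (ringChar F)) F).toAddMonoidHom

/-- The group `Sp(2n, F)` of matrices preserving the alternating form with matrix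
`[[0, I], [-I, 0]]`, acting on row vectors from the right. -/
abbrev Sp (n : ℕ) (F : Type*) [Field F] : Type _ := Matrix.symplecticGroup (Fin n) F

/-- The space `V = F²ⁿ` of row vectors `(x, y)`; `x = v ∘ Sum.inl`, `y = v ∘ Sum.inr`. -/
abbrev V (n : ℕ) (F : Type*) : Type _ := Fin n ⊕ Fin n → F

/-- The symplectic form `φ((x₁, y₁), (x₂, y₂)) = x₁ y₂ᵀ - y₁ x₂ᵀ`. -/
def phi {n : ℕ} {F : Type*} [Field F] (u v : V n F) : F :=
  (u ∘ Sum.inl) ⬝ᵥ (v ∘ Sum.inr) - (u ∘ Sum.inr) ⬝ᵥ (v ∘ Sum.inl)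

/-- The space of complex functions on `Fⁿ`, of dimension `qⁿ`. -/
abbrev H (n : ℕ) (F : Type*) : Type _ := (Fin n → F) → ℂ

/-- The Schrödinger operators `(ρ(x, y) f)(t) = ψ(2 x tᵀ - x yᵀ) f(t - y)`. They satisfy
`ρ(u) ρ(v) = ψ(φ(u, v)) ρ(u + v)`, see `schrodinger_mul`. -/
noncomputable def schrodinger {n : ℕ} {F : Type*} [Field F] [Fintype F] (v : V n F) :
    Module.End ℂ (H n F) where
  toFun f := fun t =>
    psi F (2 * ((v ∘ Sum.inl) ⬝ᵥ t) - (v ∘ Sum.inl) ⬝ᵥ (v ∘ Sum.inr)) * f (t - v ∘ Sum.inr)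
  map_add' f g := by funext t; simp [mul_add]
  map_smul' c f := by funext t; simp [mul_left_comm]

/-- The even functions on `Fⁿ`. -/
def evenPart (n : ℕ) (F : Type*) [Field F] : Submodule ℂ (H n F) where
  carrier := {f | ∀ t, f (-t) = f t}
  add_mem' := by intro f g hf hg t; simp [hf t, hg t]
  zero_mem' := by intro t; rfl
  smul_mem' := by intro c f hf t; simp [hf t]

/-- The odd functions on `Fⁿ`. -/
def oddPart (n : ℕ) (F : Type*) [Field F] : Submodule ℂ (H n F) where
  carrier := {f | ∀ t, f (-t) = -f t}
  add_mem' := by intro f g hf hg t; simp [hf t, hg t]; ring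
  zero_mem' := by intro t; simp
  smul_mem' := by intro c f hf t; simp [hf t]

variable {n : ℕ} {F : Type*} [Field F] [Fintype F]

set_option linter.unusedSectionVars false

theorem psi_two_nontrivial (hF : ringChar F ≠ 2) {a : F} (ha : a ≠ 0) :
    ∃ b : F, psi F (2 * (b * a)) ≠ 1 := by
  let _ : Algebra (ZMod (ringChar F)) F := ZMod.algebra F (ringChar F)
  have : NeZero (ringChar F) := ⟨CharP.ringChar_ne_zero_of_finite F⟩
  have h2 : (2 : F) ≠ 0 := Ring.two_ne_zero hF
  obtain ⟨b, hb⟩ := FiniteField.trace_to_zmod_nondegenerate F (mul_ne_zero h2 ha)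
  refine ⟨b, fun h => hb ?_⟩
  have h' : ZMod.stdAddChar (Algebra.trace (ZMod (ringChar F)) F (2 * (b * a))) = 1 := h
  rw [← AddChar.map_zero_eq_one (ZMod.stdAddChar (N := ringChar F))] at h'
  have := ZMod.injective_stdAddChar h'
  rw [← this]; congr 1; ring

theorem schrodinger_mul (u v : V n F) :
    schrodinger u * schrodinger v = psi F (phi u v) • schrodinger (u + v) := by
  refine LinearMap.ext fun f => funext fun t => ?_
  have e : (u + v) ∘ Sum.inr = u ∘ Sum.inr + v ∘ Sum.inr := rfl
  have e' : (u + v) ∘ Sum.inl = u ∘ Sum.inl + v ∘ Sum.inl := rfl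
  simp only [Module.End.mul_apply, schrodinger, LinearMap.coe_mk, AddHom.coe_mk,
    LinearMap.smul_apply, Pi.smul_apply, smul_eq_mul, e, e', ← mul_assoc, ← AddChar.map_add_eq_mul]
  rw [sub_sub]
  congr 2
  simp only [phi, dotProduct_add, add_dotProduct, dotProduct_sub]
  rw [dotProduct_comm (v ∘ Sum.inl) (u ∘ Sum.inr)]
  ring

theorem schrodinger_zero : schrodinger (0 : V n F) = 1 := by
  refine LinearMap.ext fun f => funext fun t => ?_
  have e : (0 : V n F) ∘ Sum.inr = 0 := rfl
  have e' : (0 : V n F) ∘ Sum.inl = 0 := rfl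
  simp [schrodinger, e, e']

theorem phi_self_neg (v : V n F) : phi v (-v) = 0 := by
  have e : (-v) ∘ Sum.inr = -(v ∘ Sum.inr) := rfl
  have e' : (-v) ∘ Sum.inl = -(v ∘ Sum.inl) := rfl
  simp [phi, e, e', dotProduct_comm]

theorem schrodinger_mul_neg (v : V n F) : schrodinger v * schrodinger (-v) = 1 := by
  rw [schrodinger_mul, phi_self_neg, add_neg_cancel, schrodinger_zero]; simp

theorem exists_phi_ne (hF : ringChar F ≠ 2) {v : V n F} (hv : v ≠ 0) :
    ∃ u : V n F, psi F (2 * phi u v) ≠ 1 := by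
  obtain ⟨i, hi⟩ := Function.ne_iff.1 hv
  rcases i with i | i
  · obtain ⟨b, hb⟩ := psi_two_nontrivial hF hi
    refine ⟨Sum.elim 0 (Pi.single i (-b)), ?_⟩
    simpa only [phi, Sum.elim_comp_inl, Sum.elim_comp_inr, zero_dotProduct, single_dotProduct,
      zero_sub, neg_mul, neg_neg, Function.comp_apply] using hb
  · obtain ⟨b, hb⟩ := psi_two_nontrivial hF hi
    refine ⟨Sum.elim (Pi.single i b) 0, ?_⟩
    simpa only [phi, Sum.elim_comp_inl, Sum.elim_comp_inr, zero_dotProduct, single_dotProduct,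
      sub_zero, Function.comp_apply] using hb

theorem trace_schrodinger (hF : ringChar F ≠ 2) {v : V n F} (hv : v ≠ 0) :
    LinearMap.trace ℂ (H n F) (schrodinger v) = 0 := by
  obtain ⟨u, hu⟩ := exists_phi_ne hF hv
  have hphi : phi u v - phi v u = 2 * phi u v := by
    simp only [phi]
    rw [dotProduct_comm (v ∘ Sum.inl), dotProduct_comm (v ∘ Sum.inr)]; ring
  have h1 : schrodinger u * schrodinger v = psi F (2 * phi u v) • (schrodinger v * schrodinger u) := by
    rw [schrodinger_mul, schrodinger_mul, smul_smul, ← AddChar.map_add_eq_mul, add_comm v u, ← hphi]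
    congr 2; ring
  have h2 : LinearMap.trace ℂ (H n F) (schrodinger u * schrodinger v * schrodinger (-u))
      = LinearMap.trace ℂ (H n F) (schrodinger v) := by
    have := schrodinger_mul_neg (-u)
    rw [neg_neg] at this
    rw [LinearMap.trace_mul_comm, ← mul_assoc, this, one_mul]
  rw [h1, smul_mul_assoc, mul_assoc, schrodinger_mul_neg, mul_one, map_smul, smul_eq_mul] at h2
  have : (psi F (2 * phi u v) - 1) * LinearMap.trace ℂ (H n F) (schrodinger v) = 0 := by
    rw [sub_mul, h2]; ring
  exact (mul_eq_zero.1 this).resolve_left (sub_ne_zero.2 hu)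

theorem linearIndependent_schrodinger (hF : ringChar F ≠ 2) :
    LinearIndependent ℂ (schrodinger : V n F → Module.End ℂ (H n F)) := by
  classical
  rw [Fintype.linearIndependent_iff]
  intro c hc w
  have h := congrArg (fun X => LinearMap.trace ℂ (H n F) (X * schrodinger (-w))) hc
  simp only [Finset.sum_mul, smul_mul_assoc, schrodinger_mul, map_sum, map_smul, zero_mul,
    map_zero, smul_eq_mul] at h
  rw [Finset.sum_eq_single w] at h
  · rw [phi_self_neg, add_neg_cancel, schrodinger_zero, LinearMap.trace_one] at h
    simpa using h
  · intro v _ hvw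
    rw [trace_schrodinger hF (by rwa [← sub_eq_add_neg, sub_ne_zero])]; simp
  · simp

/-- The Schrödinger operators form a basis of the algebra of all operators. -/
noncomputable def schrodingerBasis (hF : ringChar F ≠ 2) :
    Module.Basis (V n F) ℂ (Module.End ℂ (H n F)) := by
  classical
  exact basisOfLinearIndependentOfCardEqFinrank (linearIndependent_schrodinger hF) (by
    rw [Module.finrank_linearMap]
    simp [← pow_add])

@[simp] theorem schrodingerBasis_apply (hF : ringChar F ≠ 2) (v : V n F) :
    schrodingerBasis hF v = schrodinger v := by
  simp [schrodingerBasis]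

theorem phi_eq (u v : V n F) : phi u v = - (u ⬝ᵥ (Matrix.J (Fin n) F *ᵥ v)) := by
  simp [phi, Matrix.J, Matrix.fromBlocks_mulVec, dotProduct, Fintype.sum_sum_type, Matrix.neg_mulVec]
  ring

theorem phi_vecMul (g : Sp n F) (u v : V n F) :
    phi (u ᵥ* g.1) (v ᵥ* g.1) = phi u v := by
  rw [phi_eq, phi_eq, ← dotProduct_mulVec, Matrix.mulVec_mulVec, ← Matrix.mulVec_transpose,
    Matrix.mulVec_mulVec, (SymplecticGroup.mem_iff.1 g.2)]

/-- The algebra automorphism induced by `ρ(v) ↦ ρ(v g)`. -/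
noncomputable def actHom (hF : ringChar F ≠ 2) (g : Sp n F) :
    Module.End ℂ (H n F) →ₐ[ℂ] Module.End ℂ (H n F) :=
  AlgHom.ofLinearMap
    ((schrodingerBasis hF).constr ℂ fun v => schrodinger (v ᵥ* g.1))
    (by
      rw [← schrodinger_zero, ← schrodingerBasis_apply hF, Module.Basis.constr_basis]; simp)
    (by
      have key : ∀ v, (schrodingerBasis hF).constr ℂ
          (fun v => schrodinger (v ᵥ* g.1)) (schrodinger v)
            = schrodinger (v ᵥ* g.1) := by
        intro v; rw [← schrodingerBasis_apply hF, Module.Basis.constr_basis]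
      rw [LinearMap.map_mul_iff]
      refine (schrodingerBasis hF).ext fun u => (schrodingerBasis hF).ext fun v => ?_
      simp only [LinearMap.compr₂_apply, LinearMap.mul_apply',
        schrodingerBasis_apply, key, schrodinger_mul, map_smul, LinearMap.coe_comp,
        Function.comp_apply, LinearMap.compl₂_apply, phi_vecMul, Matrix.add_vecMul])

theorem actHom_schrodinger (hF : ringChar F ≠ 2) (g : Sp n F) (v : V n F) :
    actHom hF g (schrodinger v) = schrodinger (v ᵥ* g.1) := by
  show (schrodingerBasis hF).constr ℂ _ (schrodinger v) = _
  rw [← schrodingerBasis_apply hF, Module.Basis.constr_basis]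

theorem actHom_comp (hF : ringChar F ≠ 2) (g h : Sp n F) (X : Module.End ℂ (H n F)) :
    actHom hF h (actHom hF g X) = actHom hF (g * h) X := by
  have : (actHom hF h).toLinearMap ∘ₗ (actHom hF g).toLinearMap
      = (actHom hF (g * h)).toLinearMap := by
    refine (schrodingerBasis hF).ext fun v => ?_
    simp [actHom_schrodinger, Matrix.vecMul_vecMul]
  exact LinearMap.congr_fun this X

theorem actHom_one (hF : ringChar F ≠ 2) (X : Module.End ℂ (H n F)) :
    actHom hF 1 X = X := by
  have : (actHom hF (1 : Sp n F)).toLinearMap = LinearMap.id := by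
    refine (schrodingerBasis hF).ext fun v => ?_
    simp [actHom_schrodinger]
  exact LinearMap.congr_fun this X

/-- Every symplectic matrix is intertwined by an invertible operator. -/
theorem exists_intertwiner (hF : ringChar F ≠ 2) (g : Sp n F) :
    ∃ T : H n F ≃ₗ[ℂ] H n F, ∀ v : V n F,
      schrodinger v * T.toLinearMap = T.toLinearMap * schrodinger (v ᵥ* g.1) := by
  let e : Module.End ℂ (H n F) ≃ₐ[ℂ] Module.End ℂ (H n F) :=
    AlgEquiv.ofAlgHom (actHom hF g) (actHom hF g⁻¹)
      (by ext1 X; simp [actHom_comp, actHom_one])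
      (by ext1 X; simp [actHom_comp, actHom_one])
  obtain ⟨T, hT⟩ := e.eq_linearEquivConjAlgEquiv
  refine ⟨T.symm, fun v => ?_⟩
  have h : schrodinger (v ᵥ* g.1) = T.conjAlgEquiv ℂ (schrodinger v) := by
    rw [← hT, ← actHom_schrodinger hF]; rfl
  rw [h]
  ext f : 1
  simp [LinearEquiv.conjAlgEquiv_apply]

theorem scalar_of_commute (hF : ringChar F ≠ 2) {X : Module.End ℂ (H n F)}
    (hX : ∀ v : V n F, schrodinger v * X = X * schrodinger v) :
    ∃ c : ℂ, X = c • (1 : Module.End ℂ (H n F)) := by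
  have hc : ∀ Y, Y * X = X * Y := by
    have : (LinearMap.mulRight ℂ X) = LinearMap.mulLeft ℂ X :=
      (schrodingerBasis hF).ext fun v => by simpa using hX v
    intro Y
    exact LinearMap.congr_fun this Y
  have : X ∈ Subalgebra.center ℂ (Module.End ℂ (H n F)) :=
    Subalgebra.mem_center_iff.2 hc
  rw [Algebra.IsCentral.center_eq_bot ℂ, Algebra.mem_bot] at this
  obtain ⟨c, hc⟩ := this
  exact ⟨c, by rw [← hc, Algebra.algebraMap_eq_smul_one]⟩

/-- Inversion of the argument. -/
noncomputable def parity (n : ℕ) (F : Type*) [Field F] : Module.End ℂ (H n F) :=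
  LinearMap.funLeft ℂ ℂ (fun t : Fin n → F => -t)

theorem parity_apply (f : H n F) (t : Fin n → F) : parity n F f t = f (-t) := rfl

theorem parity_mul_parity : parity n F * parity n F = 1 := by
  refine LinearMap.ext fun f => funext fun t => ?_
  simp [parity_apply]

theorem schrodinger_mul_parity (v : V n F) :
    schrodinger v * parity n F = parity n F * schrodinger (-v) := by
  refine LinearMap.ext fun f => funext fun t => ?_
  have e : (-v) ∘ Sum.inr = -(v ∘ Sum.inr) := rfl
  have e' : (-v) ∘ Sum.inl = -(v ∘ Sum.inl) := rfl
  simp only [Module.End.mul_apply, parity_apply, schrodinger, LinearMap.coe_mk, AddHom.coe_mk,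
    e, e', neg_dotProduct_neg]
  congr 2; abel

theorem trace_parity (hF : ringChar F ≠ 2) : LinearMap.trace ℂ (H n F) (parity n F) = 1 := by
  classical
  rw [LinearMap.trace_eq_matrix_trace ℂ (Pi.basisFun ℂ (Fin n → F)), Matrix.trace]
  have h2 : (2 : F) ≠ 0 := Ring.two_ne_zero hF
  rw [Finset.sum_eq_single 0]
  · simp [parity_apply]
  · intro t _ ht
    have : -t ≠ t := by
      intro h
      apply ht
      funext i
      have hi := congrFun h i
      have : 2 * t i = 0 := by
        have : -t i = t i := hi
        linear_combination -this
      simpa [h2] using this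
    simp [parity_apply, this]
  · simp

theorem commute_parity (hF : ringChar F ≠ 2) (g : Sp n F) (T : H n F ≃ₗ[ℂ] H n F)
    (hT : ∀ v : V n F,
      schrodinger v * T.toLinearMap = T.toLinearMap * schrodinger (v ᵥ* g.1)) :
    parity n F * T.toLinearMap = T.toLinearMap * parity n F := by
  have i1 : T.symm.toLinearMap * T.toLinearMap = 1 := by ext1 f; simp
  have i2 : T.toLinearMap * T.symm.toLinearMap = 1 := by ext1 f; simp
  have hT' : ∀ v : V n F,
      T.symm.toLinearMap * schrodinger v = schrodinger (v ᵥ* g.1) * T.symm.toLinearMap := by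
    intro v
    calc _ = T.symm.toLinearMap * (schrodinger v * T.toLinearMap) * T.symm.toLinearMap := by
          rw [mul_assoc, mul_assoc, i2, mul_one]
      _ = _ := by rw [hT, ← mul_assoc, i1, one_mul]
  obtain ⟨c, hc⟩ := scalar_of_commute hF
    (X := parity n F * T.toLinearMap * parity n F * T.symm.toLinearMap) (by
      intro v
      calc _ = parity n F * (schrodinger (-v) * T.toLinearMap) * parity n F
                * T.symm.toLinearMap := by
              simp only [← mul_assoc, schrodinger_mul_parity]
        _ = parity n F * T.toLinearMap * (schrodinger (-(v ᵥ* g.1)) * parity n F)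
                * T.symm.toLinearMap := by
              rw [hT]; simp only [← mul_assoc, Matrix.neg_vecMul]
        _ = parity n F * T.toLinearMap * parity n F * (schrodinger (v ᵥ* g.1)
                * T.symm.toLinearMap) := by
              rw [schrodinger_mul_parity, neg_neg]; simp only [← mul_assoc]
        _ = _ := by rw [← hT']; simp only [← mul_assoc])
  have h1 : T.toLinearMap * parity n F * T.symm.toLinearMap = c • parity n F := by
    calc _ = parity n F * (parity n F * T.toLinearMap * parity n F * T.symm.toLinearMap) := by
            simp only [← mul_assoc, parity_mul_parity, one_mul]
      _ = _ := by rw [hc]; simp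
  have h2 := congrArg (LinearMap.trace ℂ (H n F)) h1
  rw [LinearMap.trace_mul_comm, ← mul_assoc, i1, one_mul, map_smul, trace_parity hF] at h2
  have h3 : c = 1 := by simpa using h2.symm
  rw [h3, one_smul] at h1
  calc _ = T.toLinearMap * parity n F * T.symm.toLinearMap * T.toLinearMap := by rw [h1]
    _ = _ := by rw [mul_assoc, i1, mul_one]

theorem mem_evenPart {f : H n F} : f ∈ evenPart n F ↔ parity n F f = f :=
  ⟨fun h => funext h, fun h t => congrFun h t⟩

theorem mem_oddPart {f : H n F} : f ∈ oddPart n F ↔ parity n F f = -f :=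
  ⟨fun h => funext h, fun h t => congrFun h t⟩

theorem finrank_evenPart (hF : ringChar F ≠ 2) :
    Module.finrank ℂ (evenPart n F) = Module.finrank ℂ (oddPart n F) + 1 := by
  have hP : ∀ f : H n F, parity n F (parity n F f) = f := fun f =>
    LinearMap.congr_fun parity_mul_parity f
  have he : LinearMap.IsProj (evenPart n F) ((1 / 2 : ℂ) • (1 + parity n F)) := by
    refine ⟨fun f => ?_, fun f hf => ?_⟩
    · rw [mem_evenPart]; simp [hP, add_comm]
    · rw [mem_evenPart] at hf; simp [hf, ← two_smul ℂ]
  have ho : LinearMap.IsProj (oddPart n F) ((1 / 2 : ℂ) • (1 - parity n F)) := by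
    refine ⟨fun f => ?_, fun f hf => ?_⟩
    · rw [mem_oddPart]; simp [hP, smul_sub]
    · rw [mem_oddPart] at hf; simp [hf, ← two_smul ℂ]
  have e := he.trace
  have o := ho.trace
  simp only [map_smul, map_add, map_sub, trace_parity hF, LinearMap.trace_one] at e o
  have : (Module.finrank ℂ (evenPart n F) : ℂ) = Module.finrank ℂ (oddPart n F) + 1 := by
    rw [← e, ← o]; simp only [smul_eq_mul]; ring
  exact_mod_cast this

/-- `T` is a Weil operator for `g` if `ρ(v) T = T ρ(v g)` for all `v`, and if `T`, which then
preserves the even and the odd functions, has the same determinant on both.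

The first condition determines an invertible `T` up to a scalar factor, and the second one fixes
the factor. -/
structure IsWeilOperator (g : Sp n F) (T : Module.End ℂ (H n F)) : Prop where
  intertwines : ∀ v : V n F, schrodinger v * T = T * schrodinger (v ᵥ* g.1)
  det_eq : ∃ (he : ∀ f ∈ evenPart n F, T f ∈ evenPart n F)
    (ho : ∀ f ∈ oddPart n F, T f ∈ oddPart n F),
      LinearMap.det (T.restrict he) = LinearMap.det (T.restrict ho)

theorem IsWeilOperator.mul {g h : Sp n F} {S T : Module.End ℂ (H n F)}
    (hS : IsWeilOperator g S) (hT : IsWeilOperator h T) : IsWeilOperator (g * h) (S * T) := by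
  obtain ⟨se, so, hs⟩ := hS.det_eq
  obtain ⟨te, tod, ht⟩ := hT.det_eq
  refine ⟨fun v => ?_, fun f hf => se _ (te f hf), fun f hf => so _ (tod f hf), ?_⟩
  · rw [← mul_assoc, hS.intertwines, mul_assoc, hT.intertwines, Matrix.vecMul_vecMul, mul_assoc]
    rfl
  · have e : LinearMap.restrict (S * T) (fun f hf => se _ (te f hf))
        = S.restrict se * T.restrict te := rfl
    have o : LinearMap.restrict (S * T) (fun f hf => so _ (tod f hf))
        = S.restrict so * T.restrict tod := rfl
    rw [e, o, map_mul, map_mul, hs, ht]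

theorem isWeilOperator_one : IsWeilOperator (1 : Sp n F) 1 := by
  refine ⟨fun v => by simp, fun f hf => hf, fun f hf => hf, ?_⟩
  have e : LinearMap.restrict (1 : Module.End ℂ (H n F)) (p := evenPart n F) (q := evenPart n F)
      (fun f hf => hf) = LinearMap.id := rfl
  have o : LinearMap.restrict (1 : Module.End ℂ (H n F)) (p := oddPart n F) (q := oddPart n F)
      (fun f hf => hf) = LinearMap.id := rfl
  rw [e, o, LinearMap.det_id, LinearMap.det_id]

theorem exists_isWeilOperator (hF : ringChar F ≠ 2) (g : Sp n F) :
    ∃ T : Module.End ℂ (H n F), IsWeilOperator g T ∧ IsUnit T := by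
  obtain ⟨T, hT⟩ := exists_intertwiner hF g
  have hP := commute_parity hF g T hT
  have hPf : ∀ f, parity n F (T f) = T (parity n F f) := fun f => LinearMap.congr_fun hP f
  have he : ∀ f ∈ evenPart n F, T.toLinearMap f ∈ evenPart n F := by
    intro f hf
    rw [mem_evenPart] at hf ⊢
    rw [LinearEquiv.coe_coe, hPf, hf]
  have ho : ∀ f ∈ oddPart n F, T.toLinearMap f ∈ oddPart n F := by
    intro f hf
    rw [mem_oddPart] at hf ⊢
    rw [LinearEquiv.coe_coe, hPf, hf, map_neg]
  have unit : ∀ (p : Submodule ℂ (H n F)) (hp : ∀ f ∈ p, T.toLinearMap f ∈ p),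
      LinearMap.det (T.toLinearMap.restrict hp) ≠ 0 := by
    intro p hp h0
    have hinj : LinearMap.ker (T.toLinearMap.restrict hp) = ⊥ := by
      rw [LinearMap.ker_eq_bot]
      intro a b hab
      exact Subtype.ext (T.injective (congrArg Subtype.val hab))
    exact (LinearMap.isUnit_iff_ker_eq_bot _).2 hinj |>.map LinearMap.det |>.ne_zero h0
  set a := LinearMap.det (T.toLinearMap.restrict he) with ha
  set b := LinearMap.det (T.toLinearMap.restrict ho) with hb
  have ha0 : a ≠ 0 := unit _ he
  have hb0 : b ≠ 0 := unit _ ho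
  refine ⟨(b / a) • T.toLinearMap, ⟨fun v => ?_, fun f hf => ?_, fun f hf => ?_, ?_⟩, ?_⟩
  · rw [mul_smul_comm, hT, smul_mul_assoc]
  · exact Submodule.smul_mem _ _ (he f hf)
  · exact Submodule.smul_mem _ _ (ho f hf)
  · have e : LinearMap.restrict ((b / a) • T.toLinearMap)
        (fun f hf => Submodule.smul_mem _ (b / a) (he f hf))
        = (b / a) • T.toLinearMap.restrict he := rfl
    have o : LinearMap.restrict ((b / a) • T.toLinearMap)
        (fun f hf => Submodule.smul_mem _ (b / a) (ho f hf))
        = (b / a) • T.toLinearMap.restrict ho := rfl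
    rw [e, o, LinearMap.det_smul, LinearMap.det_smul, finrank_evenPart hF, ← ha, ← hb, pow_succ]
    field_simp
  · have : IsUnit T.toLinearMap := (Module.End.isUnit_iff _).2 T.bijective
    exact this.smul (Units.mk0 (b / a) (div_ne_zero hb0 ha0))

theorem IsWeilOperator.unique (hF : ringChar F ≠ 2) {g : Sp n F} {S T : Module.End ℂ (H n F)}
    (hS : IsWeilOperator g S) (hS' : IsUnit S) (hT : IsWeilOperator g T) (hT' : IsUnit T) :
    S = T := by
  obtain ⟨T, rfl⟩ := hT'
  have h : ∀ v : V n F, schrodinger (v ᵥ* g.1) * ↑T⁻¹ = ↑T⁻¹ * schrodinger v := by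
    intro v
    calc _ = ↑T⁻¹ * (↑T * schrodinger (v ᵥ* g.1)) * ↑T⁻¹ := by
            rw [← mul_assoc, Units.inv_mul, one_mul]
      _ = _ := by rw [← hT.intertwines, mul_assoc, mul_assoc, Units.mul_inv, mul_one]
  obtain ⟨c, hc⟩ := scalar_of_commute hF (X := S * (↑T⁻¹ : Module.End ℂ (H n F))) (by
    intro v; rw [← mul_assoc, hS.intertwines, mul_assoc, h, mul_assoc])
  have hST : S = c • (T : Module.End ℂ (H n F)) := by
    calc S = S * ↑T⁻¹ * ↑T := by rw [mul_assoc, Units.inv_mul, mul_one]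
      _ = _ := by rw [hc]; simp
  subst hST
  obtain ⟨te, tod, ht⟩ := hT.det_eq
  obtain ⟨se, so, hs⟩ := hS.det_eq
  have e : LinearMap.restrict (c • (T : Module.End ℂ (H n F))) se
      = c • (T : Module.End ℂ (H n F)).restrict te := rfl
  have o : LinearMap.restrict (c • (T : Module.End ℂ (H n F))) so
      = c • (T : Module.End ℂ (H n F)).restrict tod := rfl
  rw [e, o, LinearMap.det_smul, LinearMap.det_smul, finrank_evenPart hF, ht, pow_succ] at hs
  have hd : LinearMap.det ((T : Module.End ℂ (H n F)).restrict tod) ≠ 0 := by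
    have hinj : LinearMap.ker ((T : Module.End ℂ (H n F)).restrict tod) = ⊥ := by
      rw [LinearMap.ker_eq_bot]
      intro a b hab
      exact Subtype.ext (((Module.End.isUnit_iff _).1 T.isUnit).injective
        (congrArg Subtype.val hab))
    exact ((LinearMap.isUnit_iff_ker_eq_bot _).2 hinj |>.map LinearMap.det).ne_zero
  have hc0 : c ≠ 0 := by
    rintro rfl
    rw [zero_smul] at hS'
    exact not_isUnit_zero hS'
  have hc1 : c = 1 := by
    have hp : c ^ Module.finrank ℂ (oddPart n F) ≠ 0 := pow_ne_zero _ hc0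
    have := mul_right_cancel₀ hd hs
    exact mul_left_cancel₀ hp (by rw [this, mul_one])
  rw [hc1, one_smul]

/-- A Weil representation of `Sp(2n, F)`: a representation `W` on the functions on `Fⁿ` with
`W(g)⁻¹ ρ(v) W(g) = ρ(v g)` for all `g` and `v`, such that each `W(g)` has the same determinant on
the even and on the odd functions. The quotient of the two determinants is a linear character of
`Sp(2n, F)`, so that the latter condition is automatic unless `n = 1` and `q = 3`, where it selects
one of the three representations with the former property. -/
def IsWeilRepresentation (W : Representation ℂ (Sp n F) (H n F)) : Prop :=
  ∀ g, IsWeilOperator g (W g)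

theorem existsUnique_weilRepresentation (n : ℕ) (F : Type*) [Field F] [Fintype F]
    (hF : ringChar F ≠ 2) :
    ∃! W : Representation ℂ (Sp n F) (H n F), IsWeilRepresentation W := by
  choose T hT hTu using fun g : Sp n F => exists_isWeilOperator hF g
  refine ⟨⟨⟨T, ?_⟩, ?_⟩, hT, ?_⟩
  · exact (hT 1).unique hF (hTu 1) isWeilOperator_one isUnit_one
  · intro g h
    exact (hT _).unique hF (hTu _) ((hT g).mul (hT h)) ((hTu g).mul (hTu h))
  · intro W hW
    refine MonoidHom.ext fun g => ?_
    exact (hW g).unique hF ((Group.isUnit g).map W) (hT g) (hTu g)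

/-- The Weil representation of `Sp(2n, F)`, `F` a finite field of odd characteristic. -/
noncomputable def weilRepresentation (n : ℕ) (F : Type*) [Field F] [Fintype F]
    (hF : ringChar F ≠ 2) : Representation ℂ (Sp n F) (H n F) :=
  (existsUnique_weilRepresentation n F hF).choose

theorem isWeilRepresentation_weilRepresentation (n : ℕ) (F : Type*) [Field F] [Fintype F]
    (hF : ringChar F ≠ 2) : IsWeilRepresentation (weilRepresentation n F hF) :=
  (existsUnique_weilRepresentation n F hF).choose_spec.1

/-- The Weil character `ω`. -/
noncomputable def weilCharacter (n : ℕ) (F : Type*) [Field F] [Fintype F]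
    (hF : ringChar F ≠ 2) (g : Sp n F) : ℂ :=
  LinearMap.trace ℂ (H n F) (weilRepresentation n F hF g)

/-- The element `-I` of `Sp(2n, F)`. -/
def negOne (n : ℕ) (F : Type*) [Field F] : Sp n F :=
  ⟨-1, SymplecticGroup.neg_mem (one_mem _)⟩

/-- The subgroup `B` of the matrices `g_Q = [[I, 0], [Q, I]]` with `Q` symmetric. -/
def B (n : ℕ) (F : Type*) [Field F] : Subgroup (Sp n F) where
  carrier := {g | ∃ Q : Matrix (Fin n) (Fin n) F, Q.IsSymm ∧ g.1 = Matrix.fromBlocks 1 0 Q 1}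
  mul_mem' := by
    rintro g h ⟨Q, hQ, hg⟩ ⟨R, hR, hh⟩
    refine ⟨Q + R, hQ.add hR, ?_⟩
    rw [Submonoid.coe_mul, hg, hh, Matrix.fromBlocks_multiply]
    simp
  one_mem' := ⟨0, Matrix.isSymm_zero, by rw [Matrix.fromBlocks_one]; rfl⟩
  inv_mem' := by
    rintro g ⟨Q, hQ, hg⟩
    refine ⟨-Q, hQ.neg, ?_⟩
    rw [SymplecticGroup.coe_inv', hg]
    refine Matrix.inv_eq_left_inv ?_
    rw [Matrix.fromBlocks_multiply]
    simp

/-- The subgroup `G = ⟨-I⟩ × B`, generated by `-I` and `B`. -/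
def G (n : ℕ) (F : Type*) [Field F] : Subgroup (Sp n F) :=
  Subgroup.zpowers (negOne n F) ⊔ B n F

/-- Every element of `G` is `g_Q` or `-g_Q`. -/
theorem mem_G_iff {n : ℕ} {F : Type*} [Field F] {g : Sp n F} :
    g ∈ G n F ↔ g ∈ B n F ∨ negOne n F * g ∈ B n F := by
  have hz : negOne n F * negOne n F = 1 := Subtype.ext (by simp [negOne])
  have hc : ∀ h : Sp n F, negOne n F * h = h * negOne n F := fun h =>
    Subtype.ext (by simp [negOne])
  constructor
  · intro hg
    refine Subgroup.closure_induction
      (k := (Subgroup.zpowers (negOne n F) : Set (Sp n F)) ∪ B n F)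
      (p := fun x _ => x ∈ B n F ∨ negOne n F * x ∈ B n F) ?_ ?_ ?_ ?_
      (by rwa [G, Subgroup.sup_eq_closure] at hg)
    · rintro x (hx | hx)
      · obtain ⟨k, rfl⟩ := hx
        rcases Int.even_or_odd' k with ⟨m, rfl | rfl⟩
        · left; simp [_root_.zpow_mul, zpow_ofNat, pow_two, hz, one_mem]
        · right
          simp [_root_.zpow_add, _root_.zpow_mul, zpow_ofNat, pow_two, hz, one_mem]
      · exact Or.inl hx
    · exact Or.inl (one_mem _)
    · rintro x y _ _ (hx | hx) (hy | hy)
      · exact Or.inl (mul_mem hx hy)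
      · right; rw [← mul_assoc, hc, mul_assoc]; exact mul_mem hx hy
      · right; rw [← mul_assoc]; exact mul_mem hx hy
      · left
        have := mul_mem hx hy
        rwa [hc x, mul_assoc, ← mul_assoc (negOne n F), hz, one_mul] at this
    · rintro x _ (hx | hx)
      · exact Or.inl (inv_mem hx)
      · right
        have := inv_mem hx
        rwa [_root_.mul_inv_rev, inv_eq_of_mul_eq_one_left hz, ← hc] at this
  · rintro (h | h)
    · exact (le_sup_right : B n F ≤ G n F) h
    · have h1 : negOne n F ∈ G n F :=
        (le_sup_left : Subgroup.zpowers (negOne n F) ≤ G n F) (Subgroup.mem_zpowers _)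
      have := mul_mem h1 ((le_sup_right : B n F ≤ G n F) h)
      rwa [← mul_assoc, hz, one_mul] at this

theorem toBlocks_mul {n : ℕ} {F : Type*} [Field F] {g h : Sp n F} (hg : g ∈ B n F)
    (hh : h ∈ B n F) : (g * h).1.toBlocks₂₁ = g.1.toBlocks₂₁ + h.1.toBlocks₂₁ := by
  obtain ⟨Q, -, hQ⟩ := hg
  obtain ⟨R, -, hR⟩ := hh
  rw [Submonoid.coe_mul, hQ, hR, Matrix.fromBlocks_multiply]
  simp

/-- The linear character `λ_S(g_Q) = ψ(Tr(S Q))` of `B`; here `Q` is the lower left block of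
`g_Q`. -/
noncomputable def lambdaB {n : ℕ} {F : Type*} [Field F] [Fintype F]
    (S : Matrix (Fin n) (Fin n) F) : B n F →* ℂ where
  toFun g := psi F (S * g.1.1.toBlocks₂₁).trace
  map_one' := by
    have : ((1 : B n F).1.1).toBlocks₂₁ = 0 := by
      show (1 : Matrix (Fin n ⊕ Fin n) (Fin n ⊕ Fin n) F).toBlocks₂₁ = 0
      rw [← Matrix.fromBlocks_one, Matrix.toBlocks_fromBlocks₂₁]
    rw [this]; simp
  map_mul' g h := by
    rw [Subgroup.coe_mul, toBlocks_mul g.2 h.2, mul_add, Matrix.trace_add, AddChar.map_add_eq_mul]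

open scoped Classical in
/-- The linear characters `λ_S^s` of `G`, for a sign `s = ±1`: `λ_S^s(g_Q) = ψ(Tr(S Q))` and
`λ_S^s(-g_Q) = s ψ(Tr(S Q))`. -/
noncomputable def lambdaG {n : ℕ} {F : Type*} [Field F] [Fintype F] (s : ℤˣ)
    (S : Matrix (Fin n) (Fin n) F) (g : G n F) : ℂ :=
  if h : g.1 ∈ B n F then lambdaB S ⟨g.1, h⟩
  else ((s : ℤ) : ℂ) * lambdaB S ⟨negOne n F * g.1, (mem_G_iff.1 g.2).resolve_left h⟩

open scoped Classical in
/-- The quadratic character `χ` of `F`. -/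
noncomputable def chi (F : Type*) [Field F] [Fintype F] (a : F) : ℤ := quadraticChar F a

/-- `d` is the diagonal of a diagonal matrix congruent to `Q`. -/
def IsDiagonalization {n : ℕ} {F : Type*} [Field F] (Q : Matrix (Fin n) (Fin n) F)
    (d : Fin n → F) : Prop :=
  ∃ M : Matrix (Fin n) (Fin n) F, IsUnit M ∧ M * Q * Mᵀ = Matrix.diagonal d

theorem exists_isDiagonalization {n : ℕ} {F : Type*} [Field F] (hF : ringChar F ≠ 2)
    {Q : Matrix (Fin n) (Fin n) F} (hQ : Q.IsSymm) : ∃ d, IsDiagonalization Q d := by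
  have : Invertible (2 : F) := invertibleOfNonzero (Ring.two_ne_zero hF)
  have hsymm : LinearMap.IsSymm (Matrix.toBilin' Q) := by
    refine ⟨fun x y => ?_⟩
    simp only [Matrix.toBilin'_apply', RingHom.id_apply]
    rw [dotProduct_comm, ← Matrix.vecMul_transpose, hQ.eq, ← Matrix.dotProduct_mulVec]
  obtain ⟨v, hv⟩ := LinearMap.BilinForm.exists_orthogonal_basis hsymm
  let w : Module.Basis (Fin n) F (Fin n → F) := v.reindex (finCongr (by simp))
  refine ⟨fun i => w i ⬝ᵥ Q *ᵥ w i, Matrix.of fun i => w i, ?_, ?_⟩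
  · exact Matrix.linearIndependent_rows_iff_isUnit.1 w.linearIndependent
  · ext i j
    have e : (Matrix.of (fun i => w i) * Q * (Matrix.of fun i => w i)ᵀ) i j
        = w i ⬝ᵥ Q *ᵥ w j := by
      rw [mul_assoc]; rfl
    rw [e, Matrix.diagonal_apply]
    split_ifs with h
    · rw [h]
    · rw [← Matrix.toBilin'_apply']
      have h' : (finCongr (by simp) : Fin (Module.finrank F (Fin n → F)) ≃ Fin n).symm i
          ≠ (finCongr (by simp) : Fin (Module.finrank F (Fin n → F)) ≃ Fin n).symm j := by
        simpa using h
      have : Matrix.toBilin' Q (v ((finCongr (by simp)).symm i)) (v ((finCongr (by simp)).symm j))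
          = 0 := hv h'
      simpa [w] using this

open scoped Classical in
/-- `Δ(Q) = χ(product of the nonzero entries of d)` for a diagonal matrix `diag(d)` congruent to
the symmetric matrix `Q`. Such a `d` exists by `exists_isDiagonalization`, and the value does not
depend on it, see `Delta_eq`. -/
noncomputable def Delta {n : ℕ} {F : Type*} [Field F] [Fintype F] (Q : Matrix (Fin n) (Fin n) F) :
    ℤ :=
  if h : ∃ d, IsDiagonalization Q d then chi F (∏ i with h.choose i ≠ 0, h.choose i) else 0

open scoped Classical in
theorem chi_prod_eq {n : ℕ} {F : Type*} [Field F] [Fintype F]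
    {Q : Matrix (Fin n) (Fin n) F} {d e : Fin n → F} (hd : IsDiagonalization Q d)
    (he : IsDiagonalization Q e) :
    chi F (∏ i with d i ≠ 0, d i) = chi F (∏ i with e i ≠ 0, e i) := by
  obtain ⟨M, hM, hMd⟩ := hd
  obtain ⟨N, hN, hNe⟩ := he
  obtain ⟨M', hM'⟩ := hM.exists_left_inv
  have hT : Mᵀ * M'ᵀ = 1 := by rw [← Matrix.transpose_mul, hM', Matrix.transpose_one]
  have hP : (N * M') * Matrix.diagonal d * (N * M')ᵀ = Matrix.diagonal e := by
    rw [← hMd, ← hNe, Matrix.transpose_mul]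
    calc _ = N * (M' * M) * Q * (Mᵀ * M'ᵀ) * Nᵀ := by simp only [mul_assoc]
      _ = _ := by rw [hM', hT]; simp
  have hPu : IsUnit (N * M') := hN.mul (IsUnit.of_mul_eq_one M hM')
  generalize N * M' = P at hP hPu
  have hrank : (Matrix.diagonal d).rank = (Matrix.diagonal e).rank := by
    rw [← hP, Matrix.rank_mul_eq_left_of_isUnit_det, Matrix.rank_mul_eq_right_of_isUnit_det]
    · exact (Matrix.isUnit_iff_isUnit_det _).1 hPu
    · rw [Matrix.det_transpose]; exact (Matrix.isUnit_iff_isUnit_det _).1 hPu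
  rw [Matrix.rank_diagonal, Matrix.rank_diagonal] at hrank
  let σ : {i // e i ≠ 0} ≃ {i // d i ≠ 0} := Fintype.equivOfCardEq (by simpa using hrank.symm)
  let R : Matrix {i // e i ≠ 0} {i // e i ≠ 0} F := Matrix.of fun i j => P i (σ j)
  have hR : R * Matrix.diagonal (fun j => d (σ j)) * Rᵀ
      = Matrix.diagonal fun i : {i // e i ≠ 0} => e i := by
    ext i j
    have h := congrFun (congrFun hP i) j
    simp only [Matrix.mul_apply, Matrix.transpose_apply,
      Matrix.diagonal_apply] at h ⊢
    simp only [← Subtype.ext_iff] at h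
    rw [← h, ← Finset.sum_subset (Finset.filter_subset (fun k => d k ≠ 0) Finset.univ),
      Finset.sum_subtype (p := fun k => d k ≠ 0) _ (by simp),
      ← Equiv.sum_comp σ]
    · refine Finset.sum_congr rfl fun k _ => ?_
      simp [R]
    · intro k _ hk
      have : d k = 0 := by simpa using hk
      simp [this]
  have hdet := congrArg Matrix.det hR
  rw [Matrix.det_mul, Matrix.det_mul, Matrix.det_transpose, Matrix.det_diagonal,
    Matrix.det_diagonal, Equiv.prod_comp σ (fun j => d j)] at hdet
  have pd : ∏ i with d i ≠ 0, d i = ∏ j : {i // d i ≠ 0}, d j :=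
    Finset.prod_subtype _ (by simp) _
  have pe : ∏ i with e i ≠ 0, e i = ∏ j : {i // e i ≠ 0}, e j :=
    Finset.prod_subtype _ (by simp) _
  have hne : ∏ j : {i // e i ≠ 0}, e j ≠ 0 := Finset.prod_ne_zero_iff.2 fun j _ => j.2
  have hR0 : R.det ≠ 0 := by
    intro h0; rw [h0] at hdet; exact hne (by rw [← hdet]; ring)
  rw [pd, pe, ← hdet]
  simp only [chi]
  rw [map_mul, map_mul, mul_right_comm, ← map_mul, ← pow_two, quadraticChar_sq_one' hR0, one_mul]

open scoped Classical in
/-- `Δ(Q)` can be computed from any diagonalization of `Q`. -/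
theorem Delta_eq {n : ℕ} {F : Type*} [Field F] [Fintype F]
    {Q : Matrix (Fin n) (Fin n) F} {d : Fin n → F} (hd : IsDiagonalization Q d) :
    Delta Q = chi F (∏ i with d i ≠ 0, d i) := by
  have h : ∃ d, IsDiagonalization Q d := ⟨d, hd⟩
  rw [Delta, dif_pos h]
  exact chi_prod_eq h.choose_spec hd

open scoped Classical in
/-- The symmetric `n × n` matrices `S` of rank `1` with `Δ(S) = ε`. -/
noncomputable def rankOne (n : ℕ) (F : Type*) [Field F] [Fintype F] (ε : ℤ) :
    Finset (Matrix (Fin n) (Fin n) F) :=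
  Finset.univ.filter fun S => S.IsSymm ∧ S.rank = 1 ∧ Delta S = ε

end WeilSp

/-! The Weil operators on `G` can be written down explicitly. The operator `W(g_Q)` is
multiplication by `ψ(-t Q tᵀ)`, and `W(-I)` is `δⁿ` times the inversion `f(t) ↦ f(-t)`. An
invertible operator satisfying the intertwining relation and the determinant condition is unique, so
it suffices to check both for these candidates (`isWeilOperator_quadraticPhase`,
`isWeilOperator_negOne`). The determinant condition is what fixes the scalars: `1` for `g_Q` and
`δⁿ` for `-I`.

On `B` the trace is `∑ₜ ψ(-t Q tᵀ) = ∑ₜ ψ(Tr(-tᵀt Q))`, a sum of the characters `λ_S` with `S =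
-tᵀt`. The vector `t = 0` gives `λ_0`. The nonzero vectors cover the rank one symmetric `S` with
`Δ(S) = δ` exactly twice each, by `t` and `-t` (`sum_neg_vecMulVec`).

On `-B` the operator is `δⁿ` times inversion composed with a multiplication. Its diagonal entries
vanish except at `t = 0`, the only fixed point of `t ↦ -t`, so the trace is `δⁿ`. On the other side
`λ_S⁺ + λ_S⁻` vanishes there, and the coefficients of `λ_0⁺` and `λ_0⁻` are those that give `δⁿ` on
`-B` and `1` on `B`. -/

namespace WeilSp

open Matrix

/-! ### Multiplication operators: traces, and determinants on even and odd functions -/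

section Multiplication

variable {n : ℕ} {F : Type*}

/-- The operator of multiplication by the function `a`. -/
noncomputable def mulOperator (a : H n F) : Module.End ℂ (H n F) where
  toFun f := a * f
  map_add' := mul_add a
  map_smul' c f := mul_smul_comm c a f

@[simp] theorem mulOperator_apply (a f : H n F) (t : Fin n → F) :
    mulOperator a f t = a t * f t := rfl

theorem isUnit_mulOperator {a : H n F} (ha : ∀ t, a t ≠ 0) : IsUnit (mulOperator a) := by
  refine isUnit_iff_exists.2 ⟨mulOperator a⁻¹, ?_, ?_⟩ <;>
    refine LinearMap.ext fun f => funext fun t => ?_ <;> simp [ha t]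

theorem trace_mulOperator [Fintype F] (a : H n F) :
    LinearMap.trace ℂ (H n F) (mulOperator a) = ∑ t, a t := by
  classical
  rw [LinearMap.trace_eq_matrix_trace ℂ (Pi.basisFun ℂ (Fin n → F)), Matrix.trace]
  exact Finset.sum_congr rfl fun t _ => by simp

variable [Field F]

theorem eq_zero_of_neg_eq (hF : ringChar F ≠ 2) {t : Fin n → F} (h : -t = t) : t = 0 := by
  funext i
  have hi : -t i = t i := congrFun h i
  have h0 : 2 * t i = 0 := by linear_combination -hi
  simpa [Ring.two_ne_zero hF] using h0

theorem mulOperator_mem_evenPart {a : H n F} (ha : a ∈ evenPart n F) :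
    ∀ f ∈ evenPart n F, mulOperator a f ∈ evenPart n F :=
  fun f hf t => by rw [mulOperator_apply, mulOperator_apply, ha t, hf t]

theorem mulOperator_mem_oddPart {a : H n F} (ha : a ∈ evenPart n F) :
    ∀ f ∈ oddPart n F, mulOperator a f ∈ oddPart n F :=
  fun f hf t => by rw [mulOperator_apply, mulOperator_apply, ha t, hf t, mul_neg]

theorem apply_zero_of_mem_oddPart {f : H n F} (hf : f ∈ oddPart n F) : f 0 = 0 := by
  have h := hf 0
  rw [neg_zero] at h
  exact self_eq_neg.1 h

variable [Fintype F]

/-- In the basis of point masses only `t` with `-t = t` contributes to the diagonal, and in odd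
characteristic this means `t = 0`. -/
theorem trace_parity_mul_mulOperator (hF : ringChar F ≠ 2) (a : H n F) :
    LinearMap.trace ℂ (H n F) (parity n F * mulOperator a) = a 0 := by
  classical
  rw [LinearMap.trace_eq_matrix_trace ℂ (Pi.basisFun ℂ (Fin n → F)), Matrix.trace,
    Finset.sum_eq_single 0]
  · simp [parity_apply]
  · intro t _ ht
    have h : -t ≠ t := fun h => ht (eq_zero_of_neg_eq hF h)
    simp [parity_apply, h]
  · simp

/-- This amounts to choosing one vector from each pair `{t, -t}`, `t ≠ 0`. An arbitrary enumeration
of `Fⁿ` makes the choice: `s t` is the sign of the difference of the positions of `t` and `-t`. -/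
theorem exists_odd_sign (n : ℕ) (hF : ringChar F ≠ 2) :
    ∃ s ∈ oddPart n F, ∀ t, t ≠ 0 → s t * s t = 1 := by
  classical
  let e := Fintype.equivFin (Fin n → F)
  refine ⟨fun t => (Int.sign ((e t : ℕ) - (e (-t) : ℕ) : ℤ) : ℂ), fun t => ?_, fun t ht => ?_⟩
  · beta_reduce
    rw [neg_neg, ← neg_sub, Int.sign_neg, Int.cast_neg]
  · have h : ((e t : ℕ) - (e (-t) : ℕ) : ℤ) ≠ 0 := by
      intro h
      refine ht (eq_zero_of_neg_eq hF (e.injective (Fin.ext ?_)))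
      omega
    rw [← Int.cast_mul, ← Int.sign_mul, Int.sign_eq_one_of_pos (mul_self_pos.2 h), Int.cast_one]

/-- An even function is determined by its value at `0` and by its product with an odd function
taking the values `±1` outside `0`. -/
noncomputable def oddProdEquivEven {s : H n F} (hs : s ∈ oddPart n F)
    (hs' : ∀ t, t ≠ 0 → s t * s t = 1) : (oddPart n F × ℂ) ≃ₗ[ℂ] evenPart n F := by
  classical
  exact
  { toFun := fun x => ⟨fun t => s t * x.1.1 t + if t = 0 then x.2 else 0, fun t => by
      simp only [hs t, x.1.2 t, neg_mul_neg, neg_eq_zero]⟩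
    map_add' := fun x y => Subtype.ext <| funext fun t => by
      by_cases h : t = 0 <;> simp [h] <;> ring
    map_smul' := fun c x => Subtype.ext <| funext fun t => by
      by_cases h : t = 0 <;> simp [h] <;> ring
    invFun := fun f => (⟨fun t => s t * f.1 t, fun t => by
      simp only [hs t, f.2 t, neg_mul]⟩, f.1 0)
    left_inv := fun x => by
      refine Prod.ext (Subtype.ext <| funext fun t => ?_) ?_
      · by_cases h : t = 0
        -- At `0` both `s` and the odd component vanish; this is why the value at `0` has to be
        -- recorded separately.
        · subst h
          simp [apply_zero_of_mem_oddPart hs, apply_zero_of_mem_oddPart x.1.2]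
        · simp [h, ← mul_assoc, hs' t h]
      · simp [apply_zero_of_mem_oddPart hs]
    right_inv := fun f => Subtype.ext <| funext fun t => by
      by_cases h : t = 0
      · subst h
        simp [apply_zero_of_mem_oddPart hs]
      · simp [h, ← mul_assoc, hs' t h] }

/-- Multiplication by `a` commutes with multiplication by the odd sign function. Under
`oddProdEquivEven` its action on even functions is therefore its action on odd functions together
with the scalar `a 0` on the line `ℂ`, and `a 0 = 1` adds nothing to the determinant. -/
theorem det_mulOperator_even_eq_odd (hF : ringChar F ≠ 2) {a : H n F} (ha : a ∈ evenPart n F)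
    (ha0 : a 0 = 1) :
    LinearMap.det ((mulOperator a).restrict (mulOperator_mem_evenPart ha))
      = LinearMap.det ((mulOperator a).restrict (mulOperator_mem_oddPart ha)) := by
  obtain ⟨s, hs, hs'⟩ := exists_odd_sign n hF
  let e := oddProdEquivEven hs hs'
  have h : (mulOperator a).restrict (mulOperator_mem_evenPart ha)
      = e.toLinearMap ∘ₗ (((mulOperator a).restrict (mulOperator_mem_oddPart ha)).prodMap
        (LinearMap.id : ℂ →ₗ[ℂ] ℂ)) ∘ₗ e.symm.toLinearMap := by
    refine LinearMap.ext fun f => ?_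
    obtain ⟨x, rfl⟩ := e.surjective f
    refine Subtype.ext <| funext fun t => ?_
    simp only [LinearMap.comp_apply, LinearEquiv.coe_coe, LinearEquiv.symm_apply_apply]
    by_cases h : t = 0
    · subst h
      simp [e, oddProdEquivEven, ha0]
    · simp [e, oddProdEquivEven, h, mul_left_comm]
  rw [h, LinearMap.det_conj, LinearMap.det_prodMap, LinearMap.det_id, mul_one]

end Multiplication

/-! ### The Weil operators of `g_Q` and `-I`, and the values of `ω` -/

section WeilOperators

variable {n : ℕ} {F : Type*} [Field F] [Fintype F]

/-- The function `t ↦ ψ(-t Q tᵀ)`. -/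
noncomputable def quadraticPhase (Q : Matrix (Fin n) (Fin n) F) : H n F :=
  fun t => psi F (-(t ⬝ᵥ (Q *ᵥ t)))

theorem quadraticPhase_zero (Q : Matrix (Fin n) (Fin n) F) : quadraticPhase Q 0 = 1 := by
  simp [quadraticPhase]

theorem quadraticPhase_mem_evenPart (Q : Matrix (Fin n) (Fin n) F) :
    quadraticPhase Q ∈ evenPart n F := fun t => by
  simp [quadraticPhase, Matrix.mulVec_neg]

/-- Since `(x, y) g_Q = (x + y Q, y)`, the intertwining relation compares two phases, and they agree
on expanding `(t - y) Q (t - y)ᵀ` with `Q` symmetric. The determinant condition holds because the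
phase is even with value `1` at `0`. -/
theorem isWeilOperator_quadraticPhase (hF : ringChar F ≠ 2) {g : Sp n F}
    {Q : Matrix (Fin n) (Fin n) F} (hQ : Q.IsSymm) (hg : g.1 = Matrix.fromBlocks 1 0 Q 1) :
    IsWeilOperator g (mulOperator (quadraticPhase Q)) := by
  refine ⟨fun v => ?_, mulOperator_mem_evenPart (quadraticPhase_mem_evenPart Q),
    mulOperator_mem_oddPart (quadraticPhase_mem_evenPart Q),
    det_mulOperator_even_eq_odd hF (quadraticPhase_mem_evenPart Q) (quadraticPhase_zero Q)⟩
  refine LinearMap.ext fun f => funext fun t => ?_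
  have e₁ : (v ᵥ* g.1) ∘ Sum.inl = v ∘ Sum.inl + Q *ᵥ (v ∘ Sum.inr) := by
    rw [hg, Matrix.vecMul_fromBlocks, Sum.elim_comp_inl, Matrix.vecMul_one,
      ← Matrix.mulVec_transpose, hQ.eq]
  have e₂ : (v ᵥ* g.1) ∘ Sum.inr = v ∘ Sum.inr := by
    rw [hg, Matrix.vecMul_fromBlocks, Sum.elim_comp_inr, Matrix.vecMul_one, Matrix.vecMul_zero,
      zero_add]
  simp only [Module.End.mul_apply, mulOperator_apply, schrodinger, LinearMap.coe_mk,
    AddHom.coe_mk, quadraticPhase, e₁, e₂, ← mul_assoc, ← AddChar.map_add_eq_mul]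
  congr 2
  generalize v ∘ Sum.inl = x
  generalize v ∘ Sum.inr = y
  have hs : ∀ u w : Fin n → F, u ⬝ᵥ Q *ᵥ w = w ⬝ᵥ Q *ᵥ u := fun u w => by
    rw [dotProduct_comm, ← Matrix.vecMul_transpose, hQ.eq, ← Matrix.dotProduct_mulVec]
  simp only [Matrix.mulVec_sub, dotProduct_sub, sub_dotProduct, add_dotProduct]
  rw [hs y t, dotProduct_comm (Q *ᵥ y) t, dotProduct_comm (Q *ᵥ y) y]
  ring

theorem finrank_oddPart (n : ℕ) (F : Type*) [Field F] [Fintype F] (hF : ringChar F ≠ 2) :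
    2 * Module.finrank ℂ (oddPart n F) + 1 = Fintype.card F ^ n := by
  classical
  have hc : IsCompl (evenPart n F) (oddPart n F) := by
    refine ⟨Submodule.disjoint_def.2 fun f he ho => funext fun t => ?_,
      codisjoint_iff.2 (eq_top_iff.2 fun f _ => ?_)⟩
    · have h := (he t).symm.trans (ho t)
      exact self_eq_neg.1 h
    · refine Submodule.mem_sup.2 ⟨(1 / 2 : ℂ) • (f + parity n F f), fun t => ?_,
        (1 / 2 : ℂ) • (f - parity n F f), fun t => ?_, ?_⟩
      · simp [parity_apply, add_comm]
      · simp [parity_apply, ← mul_neg]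
      · rw [← smul_add, add_add_sub_cancel, ← two_smul ℂ f, smul_smul]
        norm_num
  have h := Submodule.finrank_add_eq_of_isCompl hc
  rw [finrank_evenPart hF, Module.finrank_fintype_fun_eq_card, Fintype.card_fun,
    Fintype.card_fin] at h
  omega

/-- Both sides are `(-1)^((qⁿ - 1)/2)`: `χ(-1) = χ₄(q)` and `χ₄` is multiplicative, while the odd
functions have dimension `(qⁿ - 1)/2`. -/
theorem chi_neg_one_pow (hF : ringChar F ≠ 2) (n : ℕ) :
    chi F (-1) ^ n = (-1) ^ Module.finrank ℂ (oddPart n F) := by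
  classical
  have h1 : chi F (-1) = ZMod.χ₄ (Fintype.card F) := by
    rw [← quadraticChar_neg_one hF, chi]
  have h2 := finrank_oddPart n F hF
  rw [h1, ← map_pow, ← Nat.cast_pow, ← h2, ZMod.χ₄_eq_neg_one_pow (by omega)]
  congr 1
  omega

theorem chi_neg_one_pow_mul_self (hF : ringChar F ≠ 2) (n : ℕ) :
    ((chi F (-1) : ℂ) ^ n) * (chi F (-1) : ℂ) ^ n = 1 := by
  rw [← Int.cast_pow, chi_neg_one_pow hF, ← Int.cast_mul, ← mul_pow]
  norm_num

/-- A multiple `c` of the inversion is `c` on even and `-c` on odd functions. With dimensions `m +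
1` and `m` the determinant condition reads `c^(m+1) = (-c)^m`, which for `c ≠ 0` means `c = (-1)^m`;
by `chi_neg_one_pow` this is `δⁿ`. -/
theorem isWeilOperator_negOne (hF : ringChar F ≠ 2) :
    IsWeilOperator (negOne n F) (((chi F (-1) : ℂ) ^ n) • parity n F) := by
  set c : ℂ := (chi F (-1) : ℂ) ^ n with hc
  have he : ∀ f ∈ evenPart n F, (c • parity n F) f = c • f := fun f hf => by
    rw [LinearMap.smul_apply, mem_evenPart.1 hf]
  have ho : ∀ f ∈ oddPart n F, (c • parity n F) f = (-c) • f := fun f hf => by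
    rw [LinearMap.smul_apply, mem_oddPart.1 hf, smul_neg, neg_smul]
  refine ⟨fun v => ?_, fun f hf => by rw [he f hf]; exact Submodule.smul_mem _ _ hf,
    fun f hf => by rw [ho f hf]; exact Submodule.smul_mem _ _ hf, ?_⟩
  · rw [mul_smul_comm, schrodinger_mul_parity, smul_mul_assoc]
    simp [negOne, Matrix.vecMul_neg]
  · have e : LinearMap.restrict (c • parity n F) (p := evenPart n F) (q := evenPart n F)
        (fun f hf => by rw [he f hf]; exact Submodule.smul_mem _ _ hf) = c • LinearMap.id :=
      LinearMap.ext fun f => Subtype.ext (he f.1 f.2)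
    have o : LinearMap.restrict (c • parity n F) (p := oddPart n F) (q := oddPart n F)
        (fun f hf => by rw [ho f hf]; exact Submodule.smul_mem _ _ hf) = (-c) • LinearMap.id :=
      LinearMap.ext fun f => Subtype.ext (ho f.1 f.2)
    rw [e, o, LinearMap.det_smul, LinearMap.det_smul, LinearMap.det_id, LinearMap.det_id,
      finrank_evenPart hF, neg_pow c, pow_succ, mul_one, mul_one, mul_comm]
    congr 1
    rw [hc, ← Int.cast_pow, chi_neg_one_pow hF]
    norm_num

theorem weilRepresentation_eq (hF : ringChar F ≠ 2) {g : Sp n F} {T : Module.End ℂ (H n F)}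
    (hT : IsWeilOperator g T) (hT' : IsUnit T) : weilRepresentation n F hF g = T :=
  (isWeilRepresentation_weilRepresentation n F hF g).unique hF
    ((Group.isUnit g).map (weilRepresentation n F hF)) hT hT'

theorem weilRepresentation_of_mem_B (hF : ringChar F ≠ 2) {g : Sp n F}
    {Q : Matrix (Fin n) (Fin n) F} (hQ : Q.IsSymm) (hg : g.1 = Matrix.fromBlocks 1 0 Q 1) :
    weilRepresentation n F hF g = mulOperator (quadraticPhase Q) :=
  weilRepresentation_eq hF (isWeilOperator_quadraticPhase hF hQ hg)
    (isUnit_mulOperator fun _ => (AddChar.val_isUnit _ _).ne_zero)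

theorem weilRepresentation_negOne (hF : ringChar F ≠ 2) :
    weilRepresentation n F hF (negOne n F) = ((chi F (-1) : ℂ) ^ n) • parity n F := by
  refine weilRepresentation_eq hF (isWeilOperator_negOne hF)
    (isUnit_iff_exists.2 ⟨((chi F (-1) : ℂ) ^ n) • parity n F, ?_, ?_⟩) <;>
  rw [smul_mul_smul_comm, parity_mul_parity, chi_neg_one_pow_mul_self hF, one_smul]

theorem weilCharacter_of_mem_B (hF : ringChar F ≠ 2) {g : Sp n F}
    {Q : Matrix (Fin n) (Fin n) F} (hQ : Q.IsSymm) (hg : g.1 = Matrix.fromBlocks 1 0 Q 1) :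
    weilCharacter n F hF g = ∑ t, quadraticPhase Q t := by
  rw [weilCharacter, weilRepresentation_of_mem_B hF hQ hg, trace_mulOperator]

theorem weilCharacter_negOne_mul (hF : ringChar F ≠ 2) {g : Sp n F} (hg : g ∈ B n F) :
    weilCharacter n F hF (negOne n F * g) = (chi F (-1) : ℂ) ^ n := by
  obtain ⟨Q, hQ, hg⟩ := hg
  rw [weilCharacter, map_mul, weilRepresentation_negOne hF, weilRepresentation_of_mem_B hF hQ hg,
    smul_mul_assoc, map_smul, trace_parity_mul_mulOperator hF, quadraticPhase_zero, smul_eq_mul,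
    mul_one]

end WeilOperators

/-! ### Rank one symmetric matrices with `Δ(S) = δ` as the matrices `-tᵀt` -/

section RankOne

variable {n : ℕ} {F : Type*} [Field F]

theorem vecMulVec_self_eq_iff {t w : Fin n → F} :
    vecMulVec t t = vecMulVec w w ↔ t = w ∨ t = -w := by
  constructor
  · intro h
    have h' : ∀ i j, t i * t j = w i * w j := fun i j => congrFun (congrFun h i) j
    by_cases hw : ∃ i, w i ≠ 0
    -- The diagonal entry at `i` gives `t i = ± w i`; the remaining entries of row or column `i`
    -- then force the same sign at every coordinate.
    · obtain ⟨i, hi⟩ := hw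
      rcases mul_self_eq_mul_self_iff.1 (h' i i) with hti | hti
      · refine Or.inl (funext fun j => mul_right_cancel₀ hi ?_)
        rw [← h' j i, hti]
      · refine Or.inr (funext fun j => mul_right_cancel₀ hi ?_)
        rw [Pi.neg_apply, neg_mul, ← h' j i, hti, mul_neg, neg_neg]
    · push Not at hw
      refine Or.inl (funext fun j => ?_)
      have := h' j j
      rw [hw j, mul_zero, mul_self_eq_zero] at this
      rw [this, hw j]
  · rintro (rfl | rfl)
    · rfl
    · rw [Matrix.neg_vecMulVec, Matrix.vecMulVec_neg, neg_neg]

theorem IsDiagonalization.rank_eq {Q : Matrix (Fin n) (Fin n) F} {d : Fin n → F}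
    (hd : IsDiagonalization Q d) : Q.rank = (diagonal d).rank := by
  obtain ⟨M, hM, h⟩ := hd
  have hM' := (Matrix.isUnit_iff_isUnit_det _).1 hM
  rw [← h, Matrix.rank_mul_eq_left_of_isUnit_det, Matrix.rank_mul_eq_right_of_isUnit_det]
  · exact hM'
  · rwa [Matrix.det_transpose]

variable [Fintype F]

theorem chi_neg_mul_self {c : F} (hc : c ≠ 0) : chi F (-(c * c)) = chi F (-1) := by
  classical
  rw [chi, chi, neg_eq_neg_one_mul, map_mul, ← pow_two, quadraticChar_sq_one' hc, mul_one]

/-- Here `χ(-d) = χ(-1)² = 1`, so `-d` is a square. -/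
theorem exists_eq_neg_mul_self {d : F} (hd : d ≠ 0) (h : chi F d = chi F (-1)) :
    ∃ c, d = -(c * c) := by
  classical
  have h1 : quadraticChar F (-d) = 1 := by
    have h' : quadraticChar F d = quadraticChar F (-1) := by
      simp only [chi] at h
      convert h
    rw [neg_eq_neg_one_mul, map_mul, h', ← pow_two,
      quadraticChar_sq_one (neg_ne_zero.2 one_ne_zero)]
  obtain ⟨c, hc⟩ := (quadraticChar_one_iff_isSquare (neg_ne_zero.2 hd)).1 h1
  exact ⟨c, by rw [← hc, neg_neg]⟩

theorem mem_rankOne {ε : ℤ} {S : Matrix (Fin n) (Fin n) F} :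
    S ∈ rankOne n F ε ↔ S.IsSymm ∧ S.rank = 1 ∧ Delta S = ε := by
  simp [rankOne]

/-- A diagonalizing congruence by `M` turns the matrix into `-uᵀu`, where `u` is the image of `w`
under `M`. Rank and `Δ` are then read off from a diagonal with a single nonzero entry `-(u i)²`. -/
theorem neg_vecMulVec_mem_rankOne (hF : ringChar F ≠ 2) {w : Fin n → F} (hw : w ≠ 0) :
    -vecMulVec w w ∈ rankOne n F (chi F (-1)) := by
  classical
  have hsymm : (-vecMulVec w w).IsSymm := by
    rw [Matrix.IsSymm, Matrix.transpose_neg, Matrix.transpose_vecMulVec]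
  obtain ⟨d, hd⟩ := exists_isDiagonalization hF hsymm
  obtain ⟨M, hM, h⟩ := id hd
  set u := M *ᵥ w with hu
  have hu0 : u ≠ 0 := fun h0 => hw (Matrix.mulVec_injective_of_isUnit hM (by
    rw [← hu, h0, Matrix.mulVec_zero]))
  rw [Matrix.mul_neg, Matrix.neg_mul, Matrix.mul_vecMulVec, Matrix.vecMulVec_mul,
    Matrix.vecMul_transpose, ← hu] at h
  have h' : ∀ i j, -(u i * u j) = diagonal d i j := fun i j => congrFun (congrFun h i) j
  obtain ⟨i, hi : u i ≠ 0⟩ := Function.ne_iff.1 hu0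
  -- As `-uᵀu` is diagonal, `u j * u i = 0` for `j ≠ i`, so `u` is supported at `i` alone.
  have hd0 : ∀ j, d j ≠ 0 ↔ j = i := by
    intro j
    have hj := h' j j
    rw [Matrix.diagonal_apply_eq] at hj
    rw [← hj, neg_ne_zero, mul_self_ne_zero]
    refine ⟨fun hj0 => ?_, fun hji => hji ▸ hi⟩
    by_contra hji
    have := h' j i
    rw [Matrix.diagonal_apply_ne _ hji, neg_eq_zero] at this
    exact (mul_ne_zero hj0 hi) this
  refine mem_rankOne.2 ⟨hsymm, ?_, ?_⟩
  · rw [hd.rank_eq, Matrix.rank_diagonal]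
    simp only [hd0]
    simp
  · rw [Delta_eq hd, ← chi_neg_mul_self hi, h' i i, Matrix.diagonal_apply_eq]
    simp only [hd0, Finset.filter_eq', Finset.mem_univ, if_true, Finset.prod_singleton]

/-- Rank one leaves a single nonzero diagonal entry `d i`, and `Δ(S) = δ` makes it `-c²`. The
diagonal matrix is then `-vᵀv` for `v` equal to `c` at `i` and `0` elsewhere; undoing the congruence
carries `v` to `w`. -/
theorem exists_eq_neg_vecMulVec (hF : ringChar F ≠ 2) {S : Matrix (Fin n) (Fin n) F}
    (hS : S ∈ rankOne n F (chi F (-1))) : ∃ w : Fin n → F, w ≠ 0 ∧ S = -vecMulVec w w := by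
  classical
  obtain ⟨hsymm, hrank, hDelta⟩ := mem_rankOne.1 hS
  obtain ⟨d, hd⟩ := exists_isDiagonalization hF hsymm
  rw [hd.rank_eq, Matrix.rank_diagonal, Fintype.card_subtype, Finset.card_eq_one] at hrank
  obtain ⟨i, hi⟩ := hrank
  have hd0 : ∀ j, d j ≠ 0 ↔ j = i := fun j => by simpa using Finset.ext_iff.1 hi j
  rw [Delta_eq hd] at hDelta
  simp only [hd0, Finset.filter_eq', Finset.mem_univ, if_true, Finset.prod_singleton] at hDelta
  have hdi : d i ≠ 0 := (hd0 i).2 rfl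
  obtain ⟨c, hc⟩ := exists_eq_neg_mul_self hdi hDelta
  obtain ⟨M, hM, h⟩ := hd
  obtain ⟨N, hN⟩ := hM.exists_left_inv
  have hT : Mᵀ * Nᵀ = 1 := by rw [← Matrix.transpose_mul, hN, Matrix.transpose_one]
  have hdiag : diagonal d = -vecMulVec (Pi.single i c) (Pi.single i c) := by
    ext j k
    rw [Matrix.diagonal_apply, Matrix.neg_apply, Matrix.vecMulVec_apply]
    by_cases hj : j = i
    · subst hj
      by_cases hk : j = k
      · subst hk
        simp [hc]
      · simp [hk, Ne.symm hk]
    · have : d j = 0 := not_not.1 fun h => hj ((hd0 j).1 h)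
      simp [hj, this]
  have hS' : S = -vecMulVec (N *ᵥ Pi.single i c) (N *ᵥ Pi.single i c) := by
    calc S = (N * M) * S * (Mᵀ * Nᵀ) := by rw [hN, hT, one_mul, mul_one]
      _ = N * (M * S * Mᵀ) * Nᵀ := by simp only [mul_assoc]
      _ = _ := by
        rw [h, hdiag, Matrix.mul_neg, Matrix.neg_mul, Matrix.mul_vecMulVec,
          Matrix.vecMulVec_mul, Matrix.vecMul_transpose]
  -- If `w` were `0`, then `S = 0` and its diagonalization would have `d i = 0`.
  refine ⟨_, fun h0 => hdi ?_, hS'⟩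
  rw [h0, Matrix.zero_vecMulVec, neg_zero] at hS'
  have := congrFun (congrFun h i) i
  rw [hS', mul_zero, zero_mul, Matrix.diagonal_apply_eq] at this
  exact this.symm

open scoped Classical in
-- The term `t = 0` is split off and the others are grouped by the value of `-tᵀt`. Each fibre is a
-- pair `{w, -w}`, with two distinct elements because the characteristic is odd.
theorem sum_neg_vecMulVec (hF : ringChar F ≠ 2) (f : Matrix (Fin n) (Fin n) F → ℂ) :
    ∑ t : Fin n → F, f (-vecMulVec t t)
      = f 0 + 2 * ∑ S ∈ rankOne n F (chi F (-1)), f S := by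
  rw [← Finset.add_sum_erase _ _ (Finset.mem_univ 0), Matrix.zero_vecMulVec, neg_zero,
    ← Finset.sum_fiberwise_of_maps_to (g := fun t => -vecMulVec t t)
      (t := rankOne n F (chi F (-1)))
      (fun t ht => neg_vecMulVec_mem_rankOne hF (Finset.ne_of_mem_erase ht)), Finset.mul_sum]
  congr 1
  refine Finset.sum_congr rfl fun S hS => ?_
  obtain ⟨w, hw, rfl⟩ := exists_eq_neg_vecMulVec hF hS
  have hfib : (Finset.univ.erase 0).filter (fun t => -vecMulVec t t = -vecMulVec w w)
      = {w, -w} := by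
    ext t
    simp only [Finset.mem_filter, Finset.mem_erase, Finset.mem_univ, and_true, neg_inj,
      vecMulVec_self_eq_iff, Finset.mem_insert, Finset.mem_singleton, and_iff_right_iff_imp]
    rintro (rfl | rfl)
    · exact hw
    · exact neg_ne_zero.2 hw
  have hne : w ≠ -w := fun h => hw (eq_zero_of_neg_eq hF h.symm)
  rw [hfib, Finset.sum_pair hne, Matrix.neg_vecMulVec, Matrix.vecMulVec_neg, neg_neg, two_mul]

end RankOne

/-! ### Decomposition of `ω` on `B` and on `G` -/

section Restriction

variable {n : ℕ} {F : Type*} [Field F]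

theorem negOne_mul_negOne_mul (g : Sp n F) : negOne n F * (negOne n F * g) = g :=
  Subtype.ext (by simp [negOne])

variable [Fintype F]

/-- From `t Q tᵀ = Tr(tᵀt Q)`: each summand of the trace of `W(g_Q)` is a value of `λ_S` with `S =
-tᵀt`. -/
theorem quadraticPhase_eq (Q : Matrix (Fin n) (Fin n) F) (t : Fin n → F) :
    quadraticPhase Q t = psi F (-vecMulVec t t * Q).trace := by
  rw [quadraticPhase, Matrix.neg_mul, Matrix.trace_neg, Matrix.vecMulVec_mul,
    Matrix.trace_vecMulVec, Matrix.dotProduct_mulVec, dotProduct_comm]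

theorem lambdaB_apply (S : Matrix (Fin n) (Fin n) F) (g : B n F) :
    lambdaB S g = psi F (S * g.1.1.toBlocks₂₁).trace := by
  rw [lambdaB, MonoidHom.coe_mk, OneHom.coe_mk]

theorem weilCharacter_eq_sum_lambdaB (hF : ringChar F ≠ 2) (g : B n F) :
    weilCharacter n F hF g.1
      = lambdaB 0 g + 2 * ∑ S ∈ rankOne n F (chi F (-1)), lambdaB S g := by
  obtain ⟨g, hgB⟩ := g
  obtain ⟨Q, hQ, hg⟩ := id hgB
  have hl : ∀ S, lambdaB S ⟨g, hgB⟩ = psi F (S * Q).trace := fun S => by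
    rw [lambdaB_apply, hg, Matrix.toBlocks_fromBlocks₂₁]
  have h := sum_neg_vecMulVec hF fun S => lambdaB S ⟨g, hgB⟩
  rw [← h, weilCharacter_of_mem_B hF hQ hg]
  exact Finset.sum_congr rfl fun t _ => by rw [hl, quadraticPhase_eq]

theorem lambdaB_zero (g : B n F) : lambdaB 0 g = 1 := by
  rw [lambdaB_apply, zero_mul, Matrix.trace_zero, AddChar.map_zero_eq_one]

theorem lambdaG_of_mem (s : ℤˣ) (S : Matrix (Fin n) (Fin n) F) {g : G n F} (h : g.1 ∈ B n F) :
    lambdaG s S g = lambdaB S ⟨g.1, h⟩ :=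
  dif_pos h

theorem lambdaG_of_notMem (s : ℤˣ) (S : Matrix (Fin n) (Fin n) F) {g : G n F}
    (h : g.1 ∉ B n F) :
    lambdaG s S g
      = ((s : ℤ) : ℂ) * lambdaB S ⟨negOne n F * g.1, (mem_G_iff.1 g.2).resolve_left h⟩ :=
  dif_neg h

theorem weilCharacter_eq_sum_lambdaG (hF : ringChar F ≠ 2) (g : G n F) :
    weilCharacter n F hF g.1 =
      (1 + (chi F (-1) : ℂ) ^ n) / 2 * lambdaG 1 0 g
        + (1 - (chi F (-1) : ℂ) ^ n) / 2 * lambdaG (-1) 0 g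
        + ∑ S ∈ rankOne n F (chi F (-1)), (lambdaG 1 S g + lambdaG (-1) S g) := by
  by_cases h : g.1 ∈ B n F
  -- On `B` the sign is invisible: the two coefficients of `λ_0` add up to `1`, and each `S`
  -- contributes `2 λ_S`.
  · simp only [lambdaG_of_mem _ _ h]
    rw [weilCharacter_eq_sum_lambdaB hF ⟨g.1, h⟩, Finset.mul_sum]
    simp only [two_mul]
    ring
  · have h' := (mem_G_iff.1 g.2).resolve_left h
    simp only [lambdaG_of_notMem _ _ h, lambdaB_zero]
    have e := weilCharacter_negOne_mul hF h'
    rw [negOne_mul_negOne_mul] at e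
    -- Off `B` the two signs cancel for every `S`, and `(1 + δⁿ)/2 - (1 - δⁿ)/2 = δⁿ` remains.
    rw [e, Finset.sum_eq_zero fun S _ => by simp]
    simp only [Units.val_one, Units.val_neg, Int.cast_one, Int.cast_neg]
    ring

end Restriction

end WeilSp

theorem theorem5p1 (n : ℕ) (hn : 1 ≤ n) (F : Type*) [Field F] [Fintype F]
    (hF : ringChar F ≠ 2) :
    (∀ g : WeilSp.G n F,
      WeilSp.weilCharacter n F hF g.1 =
        (1 + (WeilSp.chi F (-1) : ℂ) ^ n) / 2 * WeilSp.lambdaG 1 0 g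
          + (1 - (WeilSp.chi F (-1) : ℂ) ^ n) / 2 * WeilSp.lambdaG (-1) 0 g
          + ∑ S ∈ WeilSp.rankOne n F (WeilSp.chi F (-1)),
              (WeilSp.lambdaG 1 S g + WeilSp.lambdaG (-1) S g)) ∧
    (∀ g : WeilSp.B n F,
      WeilSp.weilCharacter n F hF g.1 =
        WeilSp.lambdaB 0 g
          + 2 * ∑ S ∈ WeilSp.rankOne n F (WeilSp.chi F (-1)), WeilSp.lambdaB S g) := by
  exact ⟨WeilSp.weilCharacter_eq_sum_lambdaG hF, WeilSp.weilCharacter_eq_sum_lambdaB hF⟩
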